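/- Let $X$ be a real vector space and let $\Vert\cdot,\cdot,\cdot\Vert : X\times X\times X\to\mathbb{R}$ be an $S$-norm, i.e. for all $x,y,z,x',y',z'\in X$ and $\lambda\in\mathbb{R}$: (1) $\Vert x,y,z\Vert\ge 0$, with equality if and only if $x=y=z=0$; (2) $\Vert\lambda x,\lambda y,\lambda z\Vert=|\lambda|\,\Vert x,y,z\Vert$; (3) $\Vert x+x',y+y',z+z'\Vert\le\Vert 0,x,z'\Vert+\Vert 0,y,x'\Vert+\Vert 0,z,y'\Vert$. A sequence $(x_n)$ in $X$ converges to $x\in X$ if $\Vert 0,x_n-x,x-x_n\Vert\to 0$; it is Cauchy if for every $\varepsilon>0$ there is $n_0$ with $\Vert x_n-x_m,x_m-x_l,x_l-x_n\Vert<\varepsilon$ for all $n,m,l\ge n_0$. Suppose that $X$ is an $S$-Banach space, i.e. that every Cauchy sequence converges in $X$. A set $E\subseteq X$ is closed if it equals the set of all limits of convergent sequences in $E$, and $A\subseteq X$ is bounded if there is $r>0$ with $\Vert 0,x-y,y-x\Vert<r$ for all $x,y\in A$. Let $X^*$ be the space of all linear functionals $f:X\to\mathbb{R}$ such that $x_n\to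 x$ implies $f(x_n)\to f(x)$, normed by $\Vert f\Vert=\sup\{|f(x)|:\Vert 0,x,-x\Vert\le 1\}$, and let $X^{**}$ be the space of all linear functionals on $X^*$ that are continuous for this norm. $X$ is called reflexive if the canonical map $X\to X^{**}$, $x\mapsto(f\mapsto f(x))$, is surjective. Then $X$ is reflexive if and only if for every decreasing sequence $K_1\supseteq K_2\supseteq\cdots$ of nonempty, bounded, closed and convex subsets of $X$, \[ \bigcap_{n=1}^{\infty}K_n\neq\emptyset . \] -/

import Mathlib

open Filter Topology

/-- An `S`-norm on a real vector space `X`. -/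
structure SNorm (X : Type*) [AddCommGroup X] [Module ℝ X] where
  /-- the function `(x, y, z) ↦ ‖x, y, z‖` -/
  toFun : X → X → X → ℝ
  nonneg : ∀ x y z, 0 ≤ toFun x y z
  eq_zero_iff : ∀ x y z, toFun x y z = 0 ↔ x = 0 ∧ y = 0 ∧ z = 0
  smul : ∀ (c : ℝ) (x y z : X), toFun (c • x) (c • y) (c • z) = |c| * toFun x y z
  add_le : ∀ x y z x' y' z' : X,
    toFun (x + x') (y + y') (z + z') ≤ toFun 0 x z' + toFun 0 y x' + toFun 0 z y'

namespace SNorm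

variable {X : Type*} [AddCommGroup X] [Module ℝ X]

/-- The sequence `u` converges to `x`: `‖0, u n - x, x - u n‖ → 0`. -/
def ConvergesTo (N : SNorm X) (u : ℕ → X) (x : X) : Prop :=
  Tendsto (fun n => N.toFun 0 (u n - x) (x - u n)) atTop (𝓝 0)

/-- Cauchy sequences. -/
def IsCauchySeq (N : SNorm X) (u : ℕ → X) : Prop :=
  ∀ ε > 0, ∃ n₀ : ℕ, ∀ n ≥ n₀, ∀ m ≥ n₀, ∀ l ≥ n₀,
    N.toFun (u n - u m) (u m - u l) (u l - u n) < ε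

/-- `(X, N)` is an `S`-Banach space: every Cauchy sequence converges in `X`. -/
def IsSBanach (N : SNorm X) : Prop :=
  ∀ u : ℕ → X, N.IsCauchySeq u → ∃ x, N.ConvergesTo u x

/-- The set of all limits of convergent sequences in `E`. -/
def seqClosure (N : SNorm X) (E : Set X) : Set X :=
  {x | ∃ u : ℕ → X, (∀ n, u n ∈ E) ∧ N.ConvergesTo u x}

/-- Closed sets. -/
def IsClosedSet (N : SNorm X) (E : Set X) : Prop :=
  E = N.seqClosure E

/-- Bounded sets. -/
def IsBoundedSet (N : SNorm X) (A : Set X) : Prop :=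
  ∃ r > 0, ∀ x ∈ A, ∀ y ∈ A, N.toFun 0 (x - y) (y - x) < r

/-- The dual space `X*`: all linear functionals on `X` that are continuous for the convergence
of sequences in `(X, N)`. -/
def Dual (N : SNorm X) : Submodule ℝ (X →ₗ[ℝ] ℝ) where
  carrier := {f | ∀ (u : ℕ → X) (x : X), N.ConvergesTo u x →
    Tendsto (fun n => f (u n)) atTop (𝓝 (f x))}
  zero_mem' := fun _ _ _ => by simp
  add_mem' := fun hf hg u x h => by simpa using (hf u x h).add (hg u x h)
  smul_mem' := fun c f hf u x h => by simpa using (hf u x h).const_mul c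

/-- The operator norm on the dual space: the supremum of `|f x|` over the unit ball
`{x | ‖0, x, -x‖ ≤ 1}` (the set of `x` at distance `‖0, x - 0, 0 - x‖` at most `1` from `0`). -/
noncomputable def dualNorm (N : SNorm X) (f : N.Dual) : ℝ :=
  sSup {t : ℝ | ∃ x : X, N.toFun 0 x (-x) ≤ 1 ∧ t = |f.1 x|}

/-- The bidual `X**`: all linear functionals on `X*` that are continuous for the operator norm. -/
def Bidual (N : SNorm X) : Submodule ℝ (N.Dual →ₗ[ℝ] ℝ) where
  carrier := {φ | ∀ (g : ℕ → N.Dual) (f : N.Dual),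
    Tendsto (fun n => N.dualNorm (g n - f)) atTop (𝓝 0) →
      Tendsto (fun n => φ (g n)) atTop (𝓝 (φ f))}
  zero_mem' := fun _ _ _ => by simp
  add_mem' := fun hf hg u x h => by simpa using (hf u x h).add (hg u x h)
  smul_mem' := fun c f hf u x h => by simpa using (hf u x h).const_mul c

/-- A continuous functional is bounded on the unit ball, so `dualNorm` is a genuine supremum. -/
theorem bddAbove_dualNorm (N : SNorm X) (f : N.Dual) :
    BddAbove {t : ℝ | ∃ x : X, N.toFun 0 x (-x) ≤ 1 ∧ t = |f.1 x|} := by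
  by_contra h
  rw [not_bddAbove_iff] at h
  have h' : ∀ n : ℕ, ∃ x : X, N.toFun 0 x (-x) ≤ 1 ∧ (n : ℝ) + 1 < |f.1 x| := by
    intro n
    obtain ⟨_, ⟨x, hx, rfl⟩, hn⟩ := h ((n : ℝ) + 1)
    exact ⟨x, hx, hn⟩
  choose x hx hn using h'
  have hc : N.ConvergesTo (fun n => ((1 : ℝ) / ((n : ℝ) + 1)) • x n) 0 := by
    refine squeeze_zero (fun n => N.nonneg _ _ _) (fun n => ?_)
      tendsto_one_div_add_atTop_nhds_zero_nat
    have hs := N.smul ((1 : ℝ) / ((n : ℝ) + 1)) 0 (x n) (-x n)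
    have hpos : (0 : ℝ) ≤ 1 / ((n : ℝ) + 1) := by positivity
    rw [smul_zero, smul_neg, abs_of_nonneg hpos] at hs
    rw [sub_zero, zero_sub, hs]
    exact mul_le_of_le_one_right hpos (hx n)
  have ht := (f.2 _ _ hc).abs
  rw [map_zero, abs_zero] at ht
  obtain ⟨n, hlt⟩ := (ht.eventually (gt_mem_nhds one_pos)).exists
  have hpos : (0 : ℝ) < (n : ℝ) + 1 := by positivity
  rw [map_smul, smul_eq_mul, abs_mul, abs_of_pos (by positivity), one_div,
    inv_mul_lt_iff₀ hpos, mul_one] at hlt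
  exact lt_asymm hlt (hn n)

theorem abs_apply_le (N : SNorm X) (f : N.Dual) (x : X) :
    |f.1 x| ≤ N.toFun 0 x (-x) * N.dualNorm f := by
  rcases (N.nonneg 0 x (-x)).eq_or_lt with h0 | hpos
  · have hx : x = 0 := ((N.eq_zero_iff _ _ _).1 h0.symm).2.1
    rw [← h0, hx]
    simp
  · set p := N.toFun 0 x (-x)
    have hs := N.smul p⁻¹ 0 x (-x)
    rw [smul_zero, smul_neg, abs_of_pos (inv_pos.2 hpos)] at hs
    have hle : |f.1 (p⁻¹ • x)| ≤ N.dualNorm f :=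
      le_csSup (N.bddAbove_dualNorm f) ⟨p⁻¹ • x, (hs.trans (inv_mul_cancel₀ hpos.ne')).le, rfl⟩
    rwa [map_smul, smul_eq_mul, abs_mul, abs_of_pos (inv_pos.2 hpos),
      inv_mul_le_iff₀ hpos] at hle

/-- The canonical map `X → X**`, `x ↦ (f ↦ f x)`. -/
def toBidual (N : SNorm X) : X →ₗ[ℝ] N.Bidual where
  toFun x := ⟨(LinearMap.applyₗ x).comp N.Dual.subtype, fun g f h => by
    rw [tendsto_iff_norm_sub_tendsto_zero]
    refine squeeze_zero (fun n => norm_nonneg _) (fun n => ?_)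
      (by simpa using h.const_mul (N.toFun 0 x (-x)))
    exact N.abs_apply_le (g n - f) x⟩
  map_add' x y := by ext f; exact f.1.map_add x y
  map_smul' c x := by ext f; exact f.1.map_smul c x

/-- `X` is reflexive: the canonical map `X → X**` is onto. -/
def IsReflexive (N : SNorm X) : Prop :=
  Function.Surjective N.toBidual

end SNorm

section Banach

variable {E : Type*} [NormedAddCommGroup E] [NormedSpace ℝ E]

/-- A form of Goldstine's theorem: finitely many values of an element of the bidual are
approximated by those of a vector of no larger norm. -/
theorem StrongDual.exists_norm_le_forall_abs_sub_lt (φ : StrongDual ℝ (StrongDual ℝ E))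
    (s : Finset (StrongDual ℝ E)) {ε : ℝ} (hε : 0 < ε) :
    ∃ x : E, ‖x‖ ≤ ‖φ‖ ∧ ∀ f ∈ s, |f x - φ f| < ε := by
  classical
  let T : E →ₗ[ℝ] (s → ℝ) := LinearMap.pi fun f => (f.1 : E →ₗ[ℝ] ℝ)
  let v : s → ℝ := fun f => φ f.1
  have hv : v ∈ closure (T '' Metric.closedBall 0 ‖φ‖) := by
    by_contra hv
    obtain ⟨g, u, hg, hgv⟩ := geometric_hahn_banach_closed_point
      (((convex_closedBall (0 : E) ‖φ‖).linear_image T).closure) isClosed_closure hv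
    have hsum : ∀ a : s → ℝ, g a = ∑ i, a i * g (fun j => if i = j then 1 else 0) := fun a =>
      LinearMap.pi_apply_eq_sum_univ (g : (s → ℝ) →ₗ[ℝ] ℝ) a
    let F : StrongDual ℝ E := ∑ i : s, g (fun j => if i = j then 1 else 0) • i.1
    have hF : ∀ x, F x = g (T x) := fun x => by
      rw [hsum]
      simp [F, T, mul_comm]
    have hφF : φ F = g v := by
      rw [hsum]
      simp [F, v, mul_comm]
    have hlt : ∀ x : E, ‖x‖ ≤ ‖φ‖ → F x < u := fun x hx => by
      rw [hF]
      exact hg _ (subset_closure ⟨x, by simpa using hx, rfl⟩)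
    have hφ0 : 0 ≤ ‖φ‖ := norm_nonneg φ
    have hu : 0 < u := by simpa using hlt 0 (by simpa using hφ0)
    have hle : ‖φ‖ * ‖F‖ ≤ u := by
      rw [← norm_norm φ, ← norm_smul]
      refine ContinuousLinearMap.opNorm_le_of_unit_norm hu.le fun x hx => ?_
      have h1 := hlt (‖φ‖ • x) (by simp [norm_smul, hx, abs_of_nonneg hφ0])
      have h2 := hlt (-(‖φ‖ • x)) (by simp [norm_smul, hx, abs_of_nonneg hφ0])
      rw [map_neg] at h2
      rw [map_smul] at h1 h2
      exact abs_le.2 ⟨by simpa using (neg_lt.1 h2).le, by simpa using h1.le⟩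
    have := (le_abs_self _).trans (φ.le_opNorm F)
    linarith
  obtain ⟨_, ⟨x, hx, rfl⟩, hd⟩ := Metric.mem_closure_iff.1 hv ε hε
  refine ⟨x, by simpa using hx, fun f hf => ?_⟩
  have := (dist_pi_lt_iff hε).1 hd ⟨f, hf⟩
  rwa [dist_comm, Real.dist_eq] at this

/-- If every functional agreeing with `φ` on the subspace `M` has norm greater than `θ`, then `φ`
exceeds `θ` somewhere on the unit ball of `M`. -/
theorem StrongDual.exists_mem_norm_le_one_lt (M : Submodule ℝ E) (φ : StrongDual ℝ E) {θ : ℝ}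
    (h : ∀ ψ : StrongDual ℝ E, (∀ x ∈ M, ψ x = φ x) → θ < ‖ψ‖) :
    ∃ x ∈ M, ‖x‖ ≤ 1 ∧ θ < φ x := by
  obtain ⟨ψ, hψ, hnorm⟩ := exists_extension_norm_eq M (φ.comp M.subtypeL)
  have hlt := h ψ fun x hx => hψ ⟨x, hx⟩
  rw [hnorm] at hlt
  obtain ⟨x, hx1, hx⟩ := ContinuousLinearMap.exists_lt_apply_of_lt_opNorm _ hlt
  rcases lt_abs.1 (show θ < |φ x.1| from hx) with h | h
  · exact ⟨x.1, x.2, hx1.le, h⟩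
  · exact ⟨-x.1, M.neg_mem x.2, by simpa using hx1.le, by simpa using h⟩

/-- If `φ` in the bidual is further than `θ` from the canonical image of `E`, then the functionals
vanishing on a given finite set still see a part of `φ` of norm greater than `θ`. -/
theorem StrongDual.exists_norm_le_one_forall_eq_zero_lt (φ : StrongDual ℝ (StrongDual ℝ E)) {θ : ℝ}
    (hφ : ∀ x : E, θ < ‖φ - NormedSpace.inclusionInDoubleDual ℝ E x‖) (s : Finset E) :
    ∃ f : StrongDual ℝ E, ‖f‖ ≤ 1 ∧ (∀ x ∈ s, f x = 0) ∧ θ < φ f := by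
  let J := NormedSpace.inclusionInDoubleDual ℝ E
  let M : Submodule ℝ (StrongDual ℝ E) :=
    ⨅ x : s, LinearMap.ker (J x.1 : StrongDual ℝ E →ₗ[ℝ] ℝ)
  have hM : ∀ f, f ∈ M ↔ ∀ x ∈ s, f x = 0 := fun f => by
    simp [M, J, Submodule.mem_iInf]
  obtain ⟨f, hfM, hf1, hf⟩ := StrongDual.exists_mem_norm_le_one_lt M φ (θ := θ) fun ψ hψ => by
    have hspan : ((φ - ψ : StrongDual ℝ (StrongDual ℝ E)) : StrongDual ℝ E →ₗ[ℝ] ℝ) ∈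
        Submodule.span ℝ (Set.range fun x : s => (J x.1 : StrongDual ℝ E →ₗ[ℝ] ℝ)) :=
      mem_span_of_iInf_ker_le_ker fun f hf => by simp [hψ f hf]
    obtain ⟨c, hc⟩ := (Submodule.mem_span_range_iff_exists_fun ℝ).1 hspan
    have hx : φ - ψ = J (∑ i, c i • i.1) := ContinuousLinearMap.ext fun f => by
      have := (LinearMap.congr_fun hc f).symm
      simp [LinearMap.sum_apply, J] at this
      simp [J, this]
    rw [← sub_sub_self φ ψ, hx]
    exact hφ _
  exact ⟨f, hf1, (hM f).1 hfM, hf⟩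

/-- In a non-reflexive Banach space there are bounded sequences `f` and `x` such that `f m` is
bounded below by a positive constant on `x n` for `m ≤ n` and vanishes at `x n` for `n < m`. -/
theorem StrongDual.exists_seq_of_notMem_range [CompleteSpace E]
    (φ : StrongDual ℝ (StrongDual ℝ E))
    (hφ : φ ∉ Set.range (NormedSpace.inclusionInDoubleDual ℝ E)) :
    ∃ θ > 0, ∃ (f : ℕ → StrongDual ℝ E) (x : ℕ → E), (∀ n, ‖f n‖ ≤ 1) ∧ (∀ n, ‖x n‖ ≤ ‖φ‖) ∧
      (∀ m n, m ≤ n → θ ≤ f m (x n)) ∧ ∀ m n, m < n → f n (x m) = 0 := by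
  classical
  have hisom : Isometry (NormedSpace.inclusionInDoubleDual ℝ E) :=
    (NormedSpace.inclusionInDoubleDualLi (E := E) ℝ).isometry
  have hclosed := hisom.isClosedEmbedding.isClosed_range
  have hpos := (hclosed.notMem_iff_infDist_pos (Set.range_nonempty _)).1 hφ
  set d := Metric.infDist φ (Set.range (NormedSpace.inclusionInDoubleDual ℝ E))
  have hd : ∀ x : E, d / 2 < ‖φ - NormedSpace.inclusionInDoubleDual ℝ E x‖ := fun x => by
    have h := (half_lt_self hpos).trans_le (Metric.infDist_le_dist_of_mem (x := φ) ⟨x, rfl⟩)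
    exact h.trans_eq (dist_eq_norm φ _)
  obtain ⟨u, hP, hr⟩ := exists_seq_of_forall_finset_exists
    (fun a : StrongDual ℝ E × E =>
      ‖a.1‖ ≤ 1 ∧ ‖a.2‖ ≤ ‖φ‖ ∧ d / 2 < φ a.1 ∧ d / 4 ≤ a.1 a.2)
    (fun a b => d / 4 ≤ a.1 b.2 ∧ b.1 a.2 = 0) fun s hs => by
      obtain ⟨f, hf1, hf0, hfφ⟩ :=
        StrongDual.exists_norm_le_one_forall_eq_zero_lt φ hd (s.image Prod.snd)
      obtain ⟨x, hx, hxs⟩ := StrongDual.exists_norm_le_forall_abs_sub_lt φ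
        (insert f (s.image Prod.fst)) (ε := d / 4) (by positivity)
      have key : ∀ g ∈ insert f (s.image Prod.fst), d / 2 < φ g → d / 4 ≤ g x := fun g hg hgφ => by
        have := (abs_lt.1 (hxs g hg)).1
        linarith
      exact ⟨(f, x), ⟨hf1, hx, hfφ, key f (Finset.mem_insert_self _ _) hfφ⟩, fun a ha =>
        ⟨key a.1 (Finset.mem_insert_of_mem (Finset.mem_image_of_mem _ ha)) (hs a ha).2.2.1,
          hf0 _ (Finset.mem_image_of_mem _ ha)⟩⟩
  refine ⟨d / 4, by positivity, fun n => (u n).1, fun n => (u n).2, fun n => (hP n).1,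
    fun n => (hP n).2.1, fun m n hmn => ?_, fun m n hmn => (hr m n hmn).2⟩
  rcases hmn.eq_or_lt with rfl | h
  · exact (hP m).2.2.2
  · exact (hr m n h).1

/-- A Banach space with Šmulian's intersection property is reflexive. -/
theorem NormedSpace.surjective_inclusionInDoubleDual_of_nonempty_iInter [CompleteSpace E]
    (h : ∀ K : ℕ → Set E, Antitone K →
      (∀ n, (K n).Nonempty ∧ Bornology.IsBounded (K n) ∧ IsClosed (K n) ∧ Convex ℝ (K n)) →
      (⋂ n, K n).Nonempty) :
    Function.Surjective (NormedSpace.inclusionInDoubleDual ℝ E) := by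
  by_contra hsurj
  obtain ⟨φ, hφ⟩ : ∃ φ, φ ∉ Set.range (NormedSpace.inclusionInDoubleDual ℝ E) := by
    simpa [Function.Surjective] using hsurj
  obtain ⟨θ, hθ, f, x, hf, hx, hle, hzero⟩ := StrongDual.exists_seq_of_notMem_range φ hφ
  obtain ⟨z, hz⟩ := h (fun n => closure (convexHull ℝ (x '' Set.Ici n)))
    (fun m n hmn => closure_mono (convexHull_mono (Set.image_mono (Set.Ici_subset_Ici.2 hmn))))
    (fun n => ⟨((Set.nonempty_Ici.image x).convexHull).closure, by
      refine ((isBounded_convexHull.2 ?_)).closure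
      refine (Metric.isBounded_closedBall (x := (0 : E)) (r := ‖φ‖)).subset ?_
      rintro _ ⟨j, -, rfl⟩
      simpa using hx j, isClosed_closure, (convex_convexHull ℝ _).closure⟩)
  rw [Set.mem_iInter] at hz
  have hzf : ∀ n, θ ≤ f n z := fun n => by
    refine closure_minimal (convexHull_min ?_ ?_)
      (isClosed_le continuous_const (f n).continuous) (hz n)
    · rintro _ ⟨j, hj, rfl⟩
      exact hle n j hj
    · exact convex_halfSpace_ge (f n).isLinear θ
  obtain ⟨w, hw, hzw⟩ := Metric.mem_closure_iff.1 (hz 0) θ hθ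
  obtain ⟨n, hn⟩ : ∃ n, f n w = 0 := by
    have hconv : Convex ℝ {w : E | ∀ᶠ n in atTop, f n w = 0} := by
      intro a ha b hb s t _ _ _
      filter_upwards [ha, hb] with n hna hnb
      simp [hna, hnb]
    refine (convexHull_min (fun y hy => ?_) hconv hw).exists
    obtain ⟨j, -, rfl⟩ := hy
    filter_upwards [eventually_gt_atTop j] with n hn using hzero j n hn
  have h1 : f n z ≤ ‖z - w‖ := by
    have := (le_abs_self _).trans ((f n).le_of_opNorm_le (hf n) (z - w))
    simpa [hn] using this
  rw [dist_eq_norm] at hzw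
  linarith [hzf n]

/-- A reflexive space has Šmulian's intersection property. -/
theorem NormedSpace.nonempty_iInter_of_surjective_inclusionInDoubleDual
    (h : Function.Surjective (NormedSpace.inclusionInDoubleDual ℝ E)) (K : ℕ → Set E)
    (hanti : Antitone K) (hne : ∀ n, (K n).Nonempty) (hbdd : Bornology.IsBounded (K 0))
    (hclosed : ∀ n, IsClosed (K n)) (hconv : ∀ n, Convex ℝ (K n)) :
    (⋂ n, K n).Nonempty := by
  choose x hx using hne
  obtain ⟨C, hC⟩ := hbdd.exists_norm_le
  have hxC : ∀ n, ‖x n‖ ≤ C := fun n => hC _ (hanti (Nat.zero_le n) (hx n))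
  let U : Ultrafilter ℕ := Ultrafilter.of atTop
  have hU : (U : Filter ℕ) ≤ atTop := Ultrafilter.of_le _
  have hlim : ∀ f : StrongDual ℝ E, ∃ a, Tendsto (fun n => f (x n)) U (𝓝 a) := fun f => by
    obtain ⟨a, -, ha⟩ := (isCompact_closedBall (0 : ℝ) (‖f‖ * C)).ultrafilter_le_nhds
      (U.map fun n => f (x n)) (by
        refine le_principal_iff.2 (Filter.mem_map.2 (univ_mem' fun n => ?_))
        simpa using f.le_opNorm_of_le (hxC n))
    exact ⟨a, ha⟩
  choose L hL using hlim
  let Λ : StrongDual ℝ E →ₗ[ℝ] ℝ :=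
    { toFun := L
      map_add' := fun f g => tendsto_nhds_unique (hL (f + g)) ((hL f).add (hL g))
      map_smul' := fun c f => tendsto_nhds_unique (hL (c • f)) ((hL f).const_mul c) }
  obtain ⟨z, hz⟩ := h (Λ.mkContinuous C fun f => le_of_tendsto (hL f).norm
    (Eventually.of_forall fun n => by
      rw [mul_comm]
      exact f.le_opNorm_of_le (hxC n)))
  have hzL : ∀ f, f z = L f := fun f => congrArg (fun ψ => ψ f) hz
  refine ⟨z, Set.mem_iInter.2 fun n => ?_⟩
  by_contra hzn
  obtain ⟨f, u, hfz, hfK⟩ := geometric_hahn_banach_point_closed (hconv n) (hclosed n) hzn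
  have : u ≤ L f := ge_of_tendsto (hL f) (hU (by
    filter_upwards [eventually_ge_atTop n] with m hm using (hfK _ (hanti hm (hx m))).le))
  rw [hzL] at hfz
  exact this.not_gt hfz

end Banach
namespace SNorm

section Gauge

open scoped Pointwise

variable {X : Type*} [AddCommGroup X] [Module ℝ X] (N : SNorm X)

theorem apply_smul_neg (c : ℝ) (x : X) :
    N.toFun 0 (c • x) (-(c • x)) = |c| * N.toFun 0 x (-x) := by
  simpa using N.smul c 0 x (-x)

theorem apply_zero_neg_zero : N.toFun 0 (0 : X) (-0) = 0 := by
  simp [N.eq_zero_iff]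

theorem apply_add_neg_le (x y : X) :
    N.toFun 0 (x + y) (-(x + y)) ≤ 2 * N.toFun 0 x (-x) + N.toFun 0 y (-y) := by
  have h := N.add_le x x (-y) (-x) y (-x)
  rw [add_neg_cancel] at h
  have e : -y + -x = -(x + y) := by abel
  have hs : N.toFun 0 (-y) y = N.toFun 0 y (-y) := by
    simpa using N.apply_smul_neg (-1) y
  rw [e, hs] at h
  linarith

theorem apply_sum_neg_le {ι : Type*} (s : Finset ι) (z : ι → X) :
    N.toFun 0 (∑ i ∈ s, z i) (-∑ i ∈ s, z i) ≤ 2 * ∑ i ∈ s, N.toFun 0 (z i) (-z i) := by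
  classical
  induction s using Finset.induction_on with
  | empty => simpa using N.apply_zero_neg_zero.le
  | insert i s hi ih =>
    rw [Finset.sum_insert hi, Finset.sum_insert hi]
    linarith [N.apply_add_neg_le (z i) (∑ i ∈ s, z i)]

/-- The unit ball `{x | ‖0, x, -x‖ ≤ 1}`. -/
def unitBall : Set X := {x | N.toFun 0 x (-x) ≤ 1}

theorem balanced_unitBall : Balanced ℝ N.unitBall := by
  rw [balanced_iff_smul_mem]
  intro a ha x hx
  change N.toFun 0 (a • x) (-(a • x)) ≤ 1
  rw [N.apply_smul_neg]
  exact mul_le_one₀ ha (N.nonneg _ _ _) hx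

theorem mem_smul_unitBall {c : ℝ} (hc : c ≠ 0) {x : X} :
    x ∈ c • N.unitBall ↔ N.toFun 0 x (-x) ≤ |c| := by
  rw [Set.mem_smul_set_iff_inv_smul_mem₀ hc]
  change N.toFun 0 (c⁻¹ • x) (-(c⁻¹ • x)) ≤ 1 ↔ _
  rw [N.apply_smul_neg, abs_inv, inv_mul_le_iff₀ (abs_pos.2 hc), mul_one]

theorem absorbent_unitBall : Absorbent ℝ N.unitBall := fun x => by
  refine Absorbs.of_norm ⟨N.toFun 0 x (-x) + 1, fun c hc => ?_⟩
  rw [Real.norm_eq_abs] at hc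
  have hc0 : c ≠ 0 := abs_pos.1 (by linarith [N.nonneg 0 x (-x)])
  rw [Set.singleton_subset_iff, N.mem_smul_unitBall hc0]
  linarith

theorem apply_le_two_of_mem_convexHull {x : X} (hx : x ∈ convexHull ℝ N.unitBall) :
    N.toFun 0 x (-x) ≤ 2 := by
  rw [convexHull_eq] at hx
  obtain ⟨ι, t, w, z, hw, hsum, hz, rfl⟩ := hx
  rw [Finset.centerMass_eq_of_sum_1 _ _ hsum]
  refine (N.apply_sum_neg_le t _).trans ?_
  have : ∑ i ∈ t, N.toFun 0 (w i • z i) (-(w i • z i)) ≤ ∑ i ∈ t, w i :=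
    Finset.sum_le_sum fun i hi => by
      rw [N.apply_smul_neg, abs_of_nonneg (hw i hi)]
      exact mul_le_of_le_one_right (hw i hi) (hz i hi)
  linarith

/-- The largest seminorm below `x ↦ ‖0, x, -x‖`: the gauge of the convex hull of the unit ball. -/
noncomputable def gaugeNorm (x : X) : ℝ := gauge (convexHull ℝ N.unitBall) x

theorem absorbent_convexHull_unitBall : Absorbent ℝ (convexHull ℝ N.unitBall) :=
  N.absorbent_unitBall.mono (subset_convexHull ℝ _)

theorem gaugeNorm_le (x : X) : N.gaugeNorm x ≤ N.toFun 0 x (-x) := by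
  refine le_of_forall_gt_imp_ge_of_dense fun a ha => ?_
  have ha0 : 0 < a := (N.nonneg _ _ _).trans_lt ha
  exact gauge_le_of_mem ha0.le
    (Set.smul_set_mono (subset_convexHull ℝ _) ((N.mem_smul_unitBall ha0.ne').2 (ha.le.trans (le_abs_self a))))

theorem apply_le_two_mul_gaugeNorm (x : X) : N.toFun 0 x (-x) ≤ 2 * N.gaugeNorm x := by
  rw [← div_le_iff₀' two_pos]
  refine le_of_forall_gt_imp_ge_of_dense fun a ha => ?_
  obtain ⟨b, hb, hba, c, hc, rfl⟩ := exists_lt_of_gauge_lt N.absorbent_convexHull_unitBall ha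
  change N.toFun 0 (b • c) (-(b • c)) / 2 ≤ a
  rw [N.apply_smul_neg, abs_of_pos hb]
  nlinarith [N.apply_le_two_of_mem_convexHull hc]

theorem gaugeNorm_core : @NormedSpace.Core ℝ X _ _ _ ⟨N.gaugeNorm⟩ :=
  let : Norm X := ⟨N.gaugeNorm⟩
  { norm_nonneg := fun x => gauge_nonneg x
    norm_smul := fun c x => gauge_smul N.balanced_unitBall.convexHull c x
    norm_triangle := gauge_add_le (convex_convexHull ℝ _) N.absorbent_convexHull_unitBall
    norm_eq_zero_iff := fun x => by
      refine ⟨fun h => ?_, fun h => ?_⟩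
      · have h2 := N.apply_le_two_mul_gaugeNorm x
        rw [show N.gaugeNorm x = 0 from h, mul_zero] at h2
        exact ((N.eq_zero_iff _ _ _).1 (h2.antisymm (N.nonneg _ _ _))).2.1
      · subst h
        exact gauge_zero }

end Gauge

section Equivalent

variable {X : Type*} [NormedAddCommGroup X] [NormedSpace ℝ X] {N : SNorm X}

theorem convergesTo_iff_tendsto (h₁ : ∀ x, ‖x‖ ≤ N.toFun 0 x (-x))
    (h₂ : ∀ x, N.toFun 0 x (-x) ≤ 2 * ‖x‖) {u : ℕ → X} {x : X} :
    N.ConvergesTo u x ↔ Tendsto u atTop (𝓝 x) := by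
  rw [tendsto_iff_norm_sub_tendsto_zero, ConvergesTo]
  simp only [← neg_sub _ x]
  exact ⟨squeeze_zero (fun _ => norm_nonneg _) fun _ => h₁ _,
    fun h => squeeze_zero (fun _ => N.nonneg _ _ _) (fun _ => h₂ _) (by simpa using h.const_mul 2)⟩

theorem isClosedSet_iff_isClosed (h₁ : ∀ x, ‖x‖ ≤ N.toFun 0 x (-x))
    (h₂ : ∀ x, N.toFun 0 x (-x) ≤ 2 * ‖x‖) {K : Set X} :
    N.IsClosedSet K ↔ IsClosed K := by
  have : N.seqClosure K = closure K := by
    ext x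
    simp only [seqClosure, convergesTo_iff_tendsto h₁ h₂, mem_closure_iff_seq_limit,
      Set.mem_ofPred_eq]
  rw [IsClosedSet, this, eq_comm, closure_eq_iff_isClosed]

theorem isBoundedSet_iff_isBounded (h₁ : ∀ x, ‖x‖ ≤ N.toFun 0 x (-x))
    (h₂ : ∀ x, N.toFun 0 x (-x) ≤ 2 * ‖x‖) {K : Set X} :
    N.IsBoundedSet K ↔ Bornology.IsBounded K := by
  rw [Metric.isBounded_iff]
  constructor
  · rintro ⟨r, -, hr⟩
    refine ⟨r, fun x hx y hy => ?_⟩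
    rw [dist_eq_norm]
    have := hr x hx y hy
    rw [← neg_sub x y] at this
    exact (h₁ _).trans this.le
  · rintro ⟨C, hC⟩
    refine ⟨2 * |C| + 1, by positivity, fun x hx y hy => ?_⟩
    have := hC hx hy
    rw [dist_eq_norm] at this
    rw [← neg_sub x y]
    linarith [h₂ (x - y), le_abs_self C]

theorem apply_sub_le (N : SNorm X) (a b c : X) :
    N.toFun (a - b) (b - c) (c - a) ≤
      N.toFun 0 (a - c) (-(a - c)) + N.toFun 0 (b - c) (-(b - c)) := by
  have h := N.add_le (a - c) (b - c) 0 (-(b - c)) 0 (-(a - c))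
  have h0 := N.apply_zero_neg_zero
  rw [neg_zero] at h0
  rw [h0, add_zero, add_zero, zero_add] at h
  convert h using 2 <;> abel

theorem IsSBanach.completeSpace (h₁ : ∀ x, ‖x‖ ≤ N.toFun 0 x (-x))
    (h₂ : ∀ x, N.toFun 0 x (-x) ≤ 2 * ‖x‖) (hN : N.IsSBanach) : CompleteSpace X := by
  refine Metric.complete_of_cauchySeq_tendsto fun u hu => ?_
  obtain ⟨x, hx⟩ := hN u fun ε hε => by
    obtain ⟨n₀, hn₀⟩ := Metric.cauchySeq_iff.1 hu (ε / 4) (by positivity)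
    refine ⟨n₀, fun n hn m hm l hl => (N.apply_sub_le _ _ _).trans_lt ?_⟩
    have hnl := hn₀ n hn l hl
    have hml := hn₀ m hm l hl
    rw [dist_eq_norm] at hnl hml
    linarith [h₂ (u n - u l), h₂ (u m - u l)]
  exact ⟨x, (convergesTo_iff_tendsto h₁ h₂).1 hx⟩

theorem mem_dual_iff_continuous (h₁ : ∀ x, ‖x‖ ≤ N.toFun 0 x (-x))
    (h₂ : ∀ x, N.toFun 0 x (-x) ≤ 2 * ‖x‖) {f : X →ₗ[ℝ] ℝ} :
    f ∈ N.Dual ↔ Continuous f := by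
  rw [continuous_iff_seqContinuous]
  change (∀ (u : ℕ → X) (x : X), _ → _) ↔ _
  simp only [convergesTo_iff_tendsto h₁ h₂]
  rfl

/-- The dual of `(X, N)` is the dual of `X` for any equivalent norm. -/
def dualEquiv (h₁ : ∀ x, ‖x‖ ≤ N.toFun 0 x (-x))
    (h₂ : ∀ x, N.toFun 0 x (-x) ≤ 2 * ‖x‖) : N.Dual ≃ₗ[ℝ] StrongDual ℝ X where
  toFun f := ⟨f.1, (mem_dual_iff_continuous h₁ h₂).1 f.2⟩
  invFun f := ⟨f, (mem_dual_iff_continuous h₁ h₂).2 f.continuous⟩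
  map_add' _ _ := rfl
  map_smul' _ _ := rfl
  left_inv _ := rfl
  right_inv _ := rfl

theorem dualNorm_nonneg (f : N.Dual) : 0 ≤ N.dualNorm f :=
  Real.sSup_nonneg (by rintro _ ⟨x, -, rfl⟩; exact abs_nonneg _)

theorem norm_dualEquiv_le (h₁ : ∀ x, ‖x‖ ≤ N.toFun 0 x (-x))
    (h₂ : ∀ x, N.toFun 0 x (-x) ≤ 2 * ‖x‖) (f : N.Dual) :
    ‖dualEquiv h₁ h₂ f‖ ≤ 2 * N.dualNorm f := by
  have h0 := dualNorm_nonneg f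
  refine ContinuousLinearMap.opNorm_le_bound _ (by positivity) fun x => ?_
  calc |f.1 x| ≤ N.toFun 0 x (-x) * N.dualNorm f := N.abs_apply_le f x
    _ ≤ 2 * ‖x‖ * N.dualNorm f := by gcongr; exact h₂ x
    _ = 2 * N.dualNorm f * ‖x‖ := by ring

theorem dualNorm_le_norm_dualEquiv (h₁ : ∀ x, ‖x‖ ≤ N.toFun 0 x (-x))
    (h₂ : ∀ x, N.toFun 0 x (-x) ≤ 2 * ‖x‖) (f : N.Dual) :
    N.dualNorm f ≤ ‖dualEquiv h₁ h₂ f‖ := by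
  refine Real.sSup_le ?_ (norm_nonneg _)
  rintro _ ⟨x, hx, rfl⟩
  exact (dualEquiv h₁ h₂ f).unit_le_opNorm x ((h₁ x).trans hx)

theorem tendsto_dualNorm_sub_iff (h₁ : ∀ x, ‖x‖ ≤ N.toFun 0 x (-x))
    (h₂ : ∀ x, N.toFun 0 x (-x) ≤ 2 * ‖x‖) {g : ℕ → N.Dual} {f : N.Dual} :
    Tendsto (fun n => N.dualNorm (g n - f)) atTop (𝓝 0) ↔
      Tendsto (fun n => dualEquiv h₁ h₂ (g n)) atTop (𝓝 (dualEquiv h₁ h₂ f)) := by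
  rw [tendsto_iff_norm_sub_tendsto_zero (b := dualEquiv h₁ h₂ f)]
  change _ ↔ Tendsto (fun n => ‖dualEquiv h₁ h₂ (g n - f)‖) atTop (𝓝 0)
  exact ⟨fun h => squeeze_zero (fun _ => norm_nonneg _) (fun _ => norm_dualEquiv_le h₁ h₂ _)
      (by simpa using h.const_mul 2),
    squeeze_zero (fun _ => dualNorm_nonneg _) fun _ => dualNorm_le_norm_dualEquiv h₁ h₂ _⟩

theorem isReflexive_iff_surjective (h₁ : ∀ x, ‖x‖ ≤ N.toFun 0 x (-x))
    (h₂ : ∀ x, N.toFun 0 x (-x) ≤ 2 * ‖x‖) :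
    N.IsReflexive ↔ Function.Surjective (NormedSpace.inclusionInDoubleDual ℝ X) := by
  let e := dualEquiv h₁ h₂
  constructor
  · intro h φ
    obtain ⟨x, hx⟩ := h ⟨(φ : StrongDual ℝ X →ₗ[ℝ] ℝ).comp (e : N.Dual →ₗ[ℝ] StrongDual ℝ X),
      fun g f hg =>
        (φ.continuous.tendsto _).comp ((tendsto_dualNorm_sub_iff h₁ h₂).1 hg)⟩
    refine ⟨x, ContinuousLinearMap.ext fun f => ?_⟩
    exact LinearMap.congr_fun (congrArg Subtype.val hx) (e.symm f)
  · intro h φ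
    have hcont : Continuous (φ.1.comp (e.symm : StrongDual ℝ X →ₗ[ℝ] N.Dual)) := by
      rw [continuous_iff_seqContinuous]
      intro g f hg
      exact φ.2 (fun n => e.symm (g n)) (e.symm f) ((tendsto_dualNorm_sub_iff h₁ h₂).2 hg)
    obtain ⟨x, hx⟩ := h ⟨_, hcont⟩
    refine ⟨x, Subtype.ext (LinearMap.ext fun f => ?_)⟩
    exact congrArg (fun ψ => ψ (e f)) hx

theorem isReflexive_iff_nonempty_iInter (h₁ : ∀ x, ‖x‖ ≤ N.toFun 0 x (-x))
    (h₂ : ∀ x, N.toFun 0 x (-x) ≤ 2 * ‖x‖) (hN : N.IsSBanach) :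
    N.IsReflexive ↔
      ∀ K : ℕ → Set X, Antitone K →
        (∀ n, (K n).Nonempty ∧ N.IsBoundedSet (K n) ∧ N.IsClosedSet (K n) ∧ Convex ℝ (K n)) →
        (⋂ n, K n).Nonempty := by
  have := hN.completeSpace h₁ h₂
  simp only [isReflexive_iff_surjective h₁ h₂, isClosedSet_iff_isClosed h₁ h₂,
    isBoundedSet_iff_isBounded h₁ h₂]
  exact ⟨fun h K hanti hK => NormedSpace.nonempty_iInter_of_surjective_inclusionInDoubleDual h K
      hanti (fun n => (hK n).1) (hK 0).2.1 (fun n => (hK n).2.2.1) fun n => (hK n).2.2.2,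
    NormedSpace.surjective_inclusionInDoubleDual_of_nonempty_iInter⟩

end Equivalent

end SNorm

theorem lemma4 {X : Type*} [AddCommGroup X] [Module ℝ X] (N : SNorm X) (hN : N.IsSBanach) :
    N.IsReflexive ↔
      ∀ K : ℕ → Set X, Antitone K →
        (∀ n, (K n).Nonempty ∧ N.IsBoundedSet (K n) ∧ N.IsClosedSet (K n) ∧ Convex ℝ (K n)) →
        (⋂ n, K n).Nonempty := by
  let : Norm X := ⟨N.gaugeNorm⟩
  let : NormedAddCommGroup X := NormedAddCommGroup.ofCore N.gaugeNorm_core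
  let : NormedSpace ℝ X := NormedSpace.ofCore N.gaugeNorm_core
  exact SNorm.isReflexive_iff_nonempty_iInter (X := X) (N := N) N.gaugeNorm_le
    N.apply_le_two_mul_gaugeNorm hN
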